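/- **Theorem 1.2.** Let $M$ be a manifold with a Borel measure $\mu$ (or any measure space), let $\mathcal H=L^2(M,\mu;\mathbb R)$, let $H$ be a self-adjoint, non-negative operator on $\mathcal H$ such that $-H$ is the infinitesimal generator of a Markov semigroup $(P_t)_{t\ge0}$ with invariant measure $\mu$, and let $\{E(\lambda)\}_{\lambda\ge0}$ be the resolution of the identity of $H$. Write $\mathcal E(u)=\|H^{1/2}u\|_{\mathcal H}^2$ for the Dirichlet form and $\operatorname{Var}(u)=\|u-E(\{0\})u\|_{\mathcal H}^2$. Suppose that $\mathcal X\subset\mathcal H$ is a dense subspace with a norm $\|\cdot\|_{\mathcal X}$ such that $\mathcal X\cap D(\mathcal E)$ is dense in $D(\mathcal E)$ for the norm $(\|\cdot\|_{\mathcal H}^2+\mathcal E(\cdot))^{1/2}$, and that there are constants $r>0$, $C_1>0$, $\alpha>-1$ such that for all $u,v\in\mathcal X$ the map $\lambda\mapsto(E(\lambda)u,v)_{\mathcal H}$ is differentiable on $(0,r)$ with continuous derivative, and $$\Big|\frac{d}{d\lambda}(E(\lambda)u,v)_{\mathcal H}\Big|\le C_1\lambda^\alpha\|u\|_{\mathcal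 X}\|v\|_{\mathcal X},\qquad \lambda\in(0,r).$$ Let $u\in\mathcal X$, and suppose that there are $C_2\ge0$ and $\beta\in\mathbb R$ such that $P_tu\in\mathcal X$ and $\|P_tu\|_{\mathcal X}^2\le\|u\|_{\mathcal X}^2+C_2t^\beta$ for all $t\ge0$. Then there are numbers $K\in(0,1)$ with $$K\operatorname{Var}(u)\le\frac{C_1}{1+\alpha}\,r^{1+\alpha}\,\|u\|_{\mathcal X}^2,$$ and for every such $K$ and every $t\ge0$ $$\operatorname{Var}(P_tu)\le\Big(\operatorname{Var}(u)^{-\frac1{1+\alpha}}+C_3\int_0^t\big(\|u\|_{\mathcal X}^2+C_2s^\beta\big)^{-\frac1{1+\alpha}}\,ds\Big)^{-(1+\alpha)},\qquad C_3=2(1-K)K^{\frac1{1+\alpha}}\,\frac1{1+\alpha}\Big(\frac{1+\alpha}{C_1}\Big)^{\frac1{1+\alpha}},$$ where the right-hand side is read as $0$ if $\operatorname{Var}(u)=0$. In particular, as $t\to\infty$, $$\operatorname{Var}(P_tu)=\begin{cases}O\big((\log t)^{-(1+\alpha)}\big)&\text{if }\beta=1+\alpha,\\ O\big(t^{\beta-(1+\alpha)}\big)&\text{if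 }0<\beta<1+\alpha,\\ O\big(t^{-(1+\alpha)}\big)&\text{if }\beta\le0\text{ or }C_2=0.\end{cases}$$ -/

import Mathlib

open MeasureTheory Filter Topology Set Asymptotics
open scoped ENNReal RealInnerProductSpace

/-- A spectral family (resolution of the identity) `E(s)`, with `E(s) = E((-∞, s])`, carried by
`[0, ∞)`, on a real Hilbert space: orthogonal projections, increasing, strongly right continuous,
vanishing for `s < 0` and converging strongly to the identity as `s → ∞`. -/
structure SpectralFamily (V : Type*) [NormedAddCommGroup V] [InnerProductSpace ℝ V] where
  /-- The projection `E(s)`. -/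
  proj : ℝ → V →L[ℝ] V
  symm : ∀ s u v, ⟪proj s u, v⟫ = ⟪u, proj s v⟫
  idem : ∀ s u, proj s (proj s u) = proj s u
  nested : ∀ s t, s ≤ t → ∀ u, proj s (proj t u) = proj s u
  right_cont : ∀ s u, ContinuousWithinAt (fun t => proj t u) (Ici s) s
  eq_zero_of_neg : ∀ s, s < 0 → ∀ u, proj s u = 0
  tendsto_atTop : ∀ u, Tendsto (fun s => proj s u) atTop (𝓝 u)

namespace SpectralFamily

variable {V : Type*} [NormedAddCommGroup V] [InnerProductSpace ℝ V]

theorem inner_proj_self (E : SpectralFamily V) (s : ℝ) (u : V) :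
    ⟪E.proj s u, u⟫ = ‖E.proj s u‖ ^ 2 := by
  rw [← real_inner_self_eq_norm_sq, E.symm s u (E.proj s u), E.idem, real_inner_comm]

theorem norm_proj_le (E : SpectralFamily V) (s : ℝ) (u : V) : ‖E.proj s u‖ ≤ ‖u‖ := by
  have h1 := E.inner_proj_self s u
  have h2 := real_inner_le_norm (E.proj s u) u
  by_contra h
  have h3 : ‖u‖ < ‖E.proj s u‖ := not_le.mp h
  have h4 : 0 ≤ ‖u‖ := norm_nonneg u
  nlinarith

/-- The increasing right continuous function `s ↦ (E(s)u, u)`. -/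
noncomputable def distribution (E : SpectralFamily V) (u : V) : StieltjesFunction ℝ where
  toFun s := ⟪E.proj s u, u⟫
  mono' := by
    intro s t hst
    show ⟪E.proj s u, u⟫ ≤ ⟪E.proj t u, u⟫
    rw [inner_proj_self, inner_proj_self, ← E.nested s t hst u]
    exact pow_le_pow_left₀ (norm_nonneg _) (E.norm_proj_le s _) 2
  right_continuous' s := ContinuousWithinAt.inner (E.right_cont s u) continuousWithinAt_const

/-- The scalar spectral measure `d(E(s)u, u)`. -/
noncomputable def measure (E : SpectralFamily V) (u : V) : Measure ℝ :=
  (E.distribution u).measure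

/-- `E` is the resolution of the identity of the symmetric operator `H`, that is
`H = ∫ s dE(s)`: the domain of `H` is `{u | ∫ s² d(E(s)u, u) < ∞}` and
`(Hu, u) = ∫ s d(E(s)u, u)` there (by polarization, this determines `(Hu, v)`). -/
structure IsResolutionOf (E : SpectralFamily V) (H : V →ₗ.[ℝ] V) : Prop where
  mem_domain_iff : ∀ u : V, u ∈ H.domain ↔ ∫⁻ s, ENNReal.ofReal (s ^ 2) ∂(E.measure u) < ⊤
  inner_eq : ∀ u : H.domain, ⟪H u, (u : V)⟫ = ∫ s, s ∂(E.measure (u : V))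

/-- The Dirichlet form `‖H^{1/2} u‖² = ∫ s d(E(s)u, u)`, with value `∞` outside the domain of
`H^{1/2}`. -/
noncomputable def dirichletForm (E : SpectralFamily V) (u : V) : ℝ≥0∞ :=
  ∫⁻ s, ENNReal.ofReal s ∂(E.measure u)

/-- The domain of the Dirichlet form. -/
def formDomain (E : SpectralFamily V) : Set V := {u | E.dirichletForm u < ⊤}

/-- `Var(u) = ‖u - E({0})u‖²`; here `E({0}) = E(0)` because `E(s) = 0` for `s < 0`. -/
noncomputable def variance (E : SpectralFamily V) (u : V) : ℝ := ‖u - E.proj 0 u‖ ^ 2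

end SpectralFamily

/-- `(P_t)_{t ≥ 0}` is a Markov semigroup on `L²(M, μ; ℝ)` with invariant measure `μ`: a strongly
continuous semigroup with `0 ≤ P_t f ≤ 1` whenever `0 ≤ f ≤ 1`, and with `∫ P_t f dμ = ∫ f dμ`
(possibly infinite) for bounded non-negative `f`. Only the values at `t ≥ 0` matter. -/
structure IsMarkovSemigroup {M : Type*} [MeasurableSpace M] (μ : Measure M)
    (P : ℝ → Lp ℝ 2 μ →L[ℝ] Lp ℝ 2 μ) : Prop where
  zero : ∀ f, P 0 f = f
  add : ∀ s t, 0 ≤ s → 0 ≤ t → ∀ f, P (s + t) f = P s (P t f)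
  strong_cont : ∀ f, Tendsto (fun t => P t f) (𝓝[>] 0) (𝓝 f)
  markov : ∀ t, 0 ≤ t → ∀ f : Lp ℝ 2 μ, (∀ᵐ x ∂μ, 0 ≤ f x ∧ f x ≤ 1) →
    ∀ᵐ x ∂μ, 0 ≤ P t f x ∧ P t f x ≤ 1
  invariant : ∀ t, 0 ≤ t → ∀ f : Lp ℝ 2 μ, (∀ᵐ x ∂μ, 0 ≤ f x) → (∃ c : ℝ, ∀ᵐ x ∂μ, f x ≤ c) →
    ∫⁻ x, ENNReal.ofReal (P t f x) ∂μ = ∫⁻ x, ENNReal.ofReal (f x) ∂μ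

/-- `-H` (with its domain) is the infinitesimal generator of the semigroup `P`. -/
def IsNegGenerator {V : Type*} [NormedAddCommGroup V] [InnerProductSpace ℝ V]
    (H : V →ₗ.[ℝ] V) (P : ℝ → V →L[ℝ] V) : Prop :=
  ∀ u w : V, (u, w) ∈ H.graph ↔ Tendsto (fun t : ℝ => t⁻¹ • (P t u - u)) (𝓝[>] 0) (𝓝 (-w))

/-- The assumption on the density of states near `0`: `X` is a dense subspace, `X ∩ D(𝓔)` is dense
in `D(𝓔)` for the norm `(‖·‖² + 𝓔(·))^{1/2}`, and for `u, v ∈ X` the map `s ↦ (E(s)u, v)` is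
continuously differentiable on `(0, r)`, with derivative at most `C₁ s^α ‖u‖_X ‖v‖_X` in absolute
value. The norm of `X` is `N`. -/
structure DensityOfStatesBound {V : Type*} [NormedAddCommGroup V] [InnerProductSpace ℝ V]
    (E : SpectralFamily V) (X : Submodule ℝ V) (N : Seminorm ℝ X) (r C₁ α : ℝ) : Prop where
  norm_definite : ∀ u : X, N u = 0 → u = 0
  dense : Dense (X : Set V)
  dense_form : ∀ u ∈ E.formDomain, ∀ ε : ℝ≥0∞, 0 < ε → ∃ v ∈ (X : Set V) ∩ E.formDomain,
    ENNReal.ofReal (‖u - v‖ ^ 2) + E.dirichletForm (u - v) < ε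
  r_pos : 0 < r
  C₁_pos : 0 < C₁
  neg_one_lt : -1 < α
  differentiable : ∀ u v : X, ∀ s ∈ Ioo 0 r,
    DifferentiableAt ℝ (fun s => ⟪E.proj s (u : V), (v : V)⟫) s
  deriv_cont : ∀ u v : X, ContinuousOn (deriv fun s => ⟪E.proj s (u : V), (v : V)⟫) (Ioo 0 r)
  deriv_bound : ∀ u v : X, ∀ s ∈ Ioo 0 r,
    |deriv (fun s => ⟪E.proj s (u : V), (v : V)⟫) s| ≤ C₁ * s ^ α * N u * N v

/-- The constant `2 (1 - K) K^{1/(1+α)} (1/(1+α)) ((1+α)/C₁)^{1/(1+α)}` in the decay estimate. -/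
noncomputable def decayConstant (α C₁ K : ℝ) : ℝ :=
  2 * ((1 - K) * K ^ (1 / (1 + α))) * (1 / (1 + α)) * ((1 + α) / C₁) ^ (1 / (1 + α))

/-! The engine is a Nash inequality along the orbit. For `b < r`, Chebyshev for the spectral measure
gives `b ‖w - E(b)w‖² ≤ (Hw, w)` (`mul_norm_sq_sub_proj_le`), while integrating the density bound
from `0` to `b` controls the low-frequency mass by `C₁/(1+α) b^(1+α) N²`
(`norm_sq_proj_sub_proj_zero_le`). Choosing `b` so that this mass is `K` times the bound variable `φ
= ‖w‖²` gives a lower bound for `(Hw, w)` by a multiple of `φ^(1+1/(1+α))`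
(`nash_of_forall_threshold`).

Since `d/ds ‖P_s v‖² = -2 (H P_s v, P_s v)`, this is a differential inequality, integrated in
`le_rpow_of_deriv_right_le`. It is run on `v = E(R)u - E(0)u`, which lies in the domain of `H` even
if `u` does not; the bound is independent of `R`, and `R → ∞` gives the variance.

The spectral projections must commute with `P_t` (`proj_apply`). No functional calculus is used:
they commute with `H` because the quadratic form splits, and uniqueness for `f' = -Hf` transfers
this to `P_t`. -/

namespace SpectralFamily

/-! ### Spectral projections and scalar spectral measures. -/

variable {V : Type*} [NormedAddCommGroup V] [InnerProductSpace ℝ V]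

theorem proj_proj_of_le (E : SpectralFamily V) {s t : ℝ} (h : s ≤ t) (u : V) :
    E.proj t (E.proj s u) = E.proj s u := by
  refine ext_inner_right ℝ fun v => ?_
  rw [E.symm, E.symm, E.nested s t h, E.symm]

theorem proj_comm (E : SpectralFamily V) (s t : ℝ) (u : V) :
    E.proj t (E.proj s u) = E.proj s (E.proj t u) := by
  rcases le_total s t with h | h
  · rw [E.proj_proj_of_le h, E.nested s t h]
  · rw [E.proj_proj_of_le h, E.nested t s h]

theorem distribution_apply (E : SpectralFamily V) (u : V) (s : ℝ) :
    E.distribution u s = ‖E.proj s u‖ ^ 2 := E.inner_proj_self s u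

theorem norm_sq_sub_proj (E : SpectralFamily V) (s : ℝ) (u : V) :
    ‖u - E.proj s u‖ ^ 2 = ‖u‖ ^ 2 - ‖E.proj s u‖ ^ 2 := by
  rw [norm_sub_sq_real, real_inner_comm, E.inner_proj_self]
  ring

theorem inner_proj_sub_proj (E : SpectralFamily V) (s : ℝ) (u v : V) :
    ⟪E.proj s u, v - E.proj s v⟫ = 0 := by
  rw [E.symm, map_sub, E.idem, sub_self, inner_zero_right]

theorem tendsto_distribution_atTop (E : SpectralFamily V) (u : V) :
    Tendsto (E.distribution u) atTop (𝓝 (‖u‖ ^ 2)) :=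
  ((E.tendsto_atTop u).norm.pow 2).congr fun s => (E.distribution_apply u s).symm

theorem tendsto_distribution_atBot (E : SpectralFamily V) (u : V) :
    Tendsto (E.distribution u) atBot (𝓝 0) := by
  refine tendsto_const_nhds.congr' ?_
  filter_upwards [eventually_lt_atBot 0] with s hs
  rw [E.distribution_apply, E.eq_zero_of_neg s hs, norm_zero, zero_pow two_ne_zero]

instance isFiniteMeasure_measure (E : SpectralFamily V) (u : V) : IsFiniteMeasure (E.measure u) :=
  (E.distribution u).isFiniteMeasure (E.tendsto_distribution_atBot u)
    (E.tendsto_distribution_atTop u)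

theorem measure_Ioi (E : SpectralFamily V) (u : V) (b : ℝ) :
    E.measure u (Ioi b) = ENNReal.ofReal (‖u‖ ^ 2 - ‖E.proj b u‖ ^ 2) := by
  rw [measure, StieltjesFunction.measure_Ioi _ (E.tendsto_distribution_atTop u),
    E.distribution_apply]

theorem measure_Iio_zero (E : SpectralFamily V) (u : V) : E.measure u (Iio 0) = 0 := by
  rw [measure, StieltjesFunction.measure_Iio _ (E.tendsto_distribution_atBot u)]
  have : Function.leftLim (E.distribution u) 0 = 0 := by
    refine tendsto_nhds_unique ((E.distribution u).mono.tendsto_leftLim 0) ?_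
    refine tendsto_const_nhds.congr' ?_
    filter_upwards [self_mem_nhdsWithin] with s hs
    rw [E.distribution_apply, E.eq_zero_of_neg s hs, norm_zero, zero_pow two_ne_zero]
  rw [this, sub_zero, ENNReal.ofReal_zero]

theorem ae_nonneg (E : SpectralFamily V) (u : V) : ∀ᵐ s ∂E.measure u, 0 ≤ s := by
  rw [ae_iff]
  convert! E.measure_Iio_zero u using 2
  ext s
  simp

theorem ae_le_of_proj_eq (E : SpectralFamily V) {u : V} {b : ℝ} (h : E.proj b u = u) :
    ∀ᵐ s ∂E.measure u, s ≤ b := by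
  rw [ae_iff]
  have := E.measure_Ioi u b
  rw [h, sub_self, ENNReal.ofReal_zero] at this
  convert! this using 2
  ext s
  simp

/-- All `E(s)` commute with `E(b)`, so the cross terms between the ranges of `E(b)` and `1 - E(b)`
vanish in the distribution function. -/
theorem measure_eq_add (E : SpectralFamily V) (b : ℝ) (u : V) :
    E.measure u = E.measure (E.proj b u) + E.measure (u - E.proj b u) := by
  rw [measure, measure, measure, ← StieltjesFunction.measure_add]
  congr 1
  ext s
  rw [StieltjesFunction.add_apply]
  change ⟪E.proj s u, u⟫ = ⟪E.proj s (E.proj b u), E.proj b u⟫ +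
    ⟪E.proj s (u - E.proj b u), u - E.proj b u⟫
  have h1 : ⟪E.proj s (E.proj b u), u - E.proj b u⟫ = 0 := by
    rw [E.proj_comm, E.inner_proj_sub_proj]
  have h2 : ⟪E.proj s (u - E.proj b u), E.proj b u⟫ = 0 := by
    rw [E.symm, E.proj_comm, real_inner_comm, E.inner_proj_sub_proj]
  conv_lhs => rw [← add_sub_cancel (E.proj b u) u]
  rw [map_add, inner_add_left, inner_add_right, inner_add_right, h1, h2]
  ring

/-! ### Commutation of `H` with its spectral projections. -/

namespace IsResolutionOf

variable {E : SpectralFamily V} {H : V →ₗ.[ℝ] V}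

theorem mem_domain_of_proj_eq (hE : E.IsResolutionOf H) {u : V} {b : ℝ} (h : E.proj b u = u) :
    u ∈ H.domain := by
  rw [hE.mem_domain_iff]
  calc ∫⁻ s, ENNReal.ofReal (s ^ 2) ∂E.measure u
      ≤ ∫⁻ _, ENNReal.ofReal (b ^ 2) ∂E.measure u := by
        refine lintegral_mono_ae ?_
        filter_upwards [E.ae_nonneg u, E.ae_le_of_proj_eq h] with s h0 hb
        exact ENNReal.ofReal_le_ofReal (pow_le_pow_left₀ h0 hb 2)
    _ < ⊤ := by
        rw [lintegral_const]
        exact ENNReal.mul_lt_top ENNReal.ofReal_lt_top (measure_lt_top _ _)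

theorem proj_mem_domain (hE : E.IsResolutionOf H) (b : ℝ) (u : V) : E.proj b u ∈ H.domain :=
  hE.mem_domain_of_proj_eq (E.idem b u)

theorem sub_proj_mem_domain (hE : E.IsResolutionOf H) (b : ℝ) (u : H.domain) :
    (u : V) - E.proj b u ∈ H.domain :=
  H.domain.sub_mem u.2 (hE.proj_mem_domain b u)

theorem dense_domain (hE : E.IsResolutionOf H) : Dense (H.domain : Set V) := fun u =>
  mem_closure_of_tendsto (E.tendsto_atTop u) (Eventually.of_forall fun s => hE.proj_mem_domain s u)

theorem integrable_id (hE : E.IsResolutionOf H) {u : V} (hu : u ∈ H.domain) :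
    Integrable (fun s : ℝ => s) (E.measure u) := by
  have h2 : Integrable (fun s : ℝ => s ^ 2) (E.measure u) := by
    refine ⟨by fun_prop, ?_⟩
    rw [hasFiniteIntegral_iff_ofReal (Eventually.of_forall fun s => sq_nonneg s)]
    exact (hE.mem_domain_iff u).1 hu
  refine (h2.add (integrable_const (1 : ℝ))).mono' (by fun_prop) (Eventually.of_forall fun s => ?_)
  simp only [Pi.add_apply, Real.norm_eq_abs]
  nlinarith [sq_abs s, sq_nonneg (|s| - 1), abs_nonneg s]

/-- Chebyshev's inequality on `(b, ∞)`, whose spectral mass is `‖u - E(b)u‖²`. -/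
theorem mul_norm_sq_sub_proj_le (hE : E.IsResolutionOf H) (u : H.domain) (b : ℝ) :
    b * ‖(u : V) - E.proj b u‖ ^ 2 ≤ ⟪H u, (u : V)⟫ := by
  have hint := hE.integrable_id u.2
  rw [hE.inner_eq u]
  have h1 : ∫ _ in Ioi b, b ∂E.measure (u : V) = b * ‖(u : V) - E.proj b u‖ ^ 2 := by
    rw [setIntegral_const, measureReal_def, E.measure_Ioi, ← E.norm_sq_sub_proj,
      ENNReal.toReal_ofReal (sq_nonneg _), smul_eq_mul, mul_comm]
  rw [← h1]
  calc ∫ _ in Ioi b, b ∂E.measure (u : V) ≤ ∫ s in Ioi b, s ∂E.measure (u : V) :=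
        setIntegral_mono_on (integrable_const _).integrableOn hint.integrableOn measurableSet_Ioi
          fun s hs => hs.le
    _ ≤ ∫ s, s ∂E.measure (u : V) := setIntegral_le_integral hint (E.ae_nonneg u)

theorem inner_nonneg (hE : E.IsResolutionOf H) (u : H.domain) : 0 ≤ ⟪H u, (u : V)⟫ := by
  rw [hE.inner_eq u]
  exact integral_nonneg_of_ae (E.ae_nonneg u)

/-- Splitting the spectral measure makes the quadratic form additive over the two pieces, so the two
cross terms sum to zero; by symmetry they are equal. -/
theorem inner_proj_sub_proj_self (hE : E.IsResolutionOf H) (hH : H.IsFormalAdjoint H) (b : ℝ)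
    (u : H.domain) :
    ⟪H ⟨E.proj b u, hE.proj_mem_domain b u⟩, (u : V) - E.proj b u⟫ = 0 := by
  set f : H.domain := ⟨E.proj b u, hE.proj_mem_domain b u⟩ with hf
  set g : H.domain := ⟨(u : V) - E.proj b u, hE.sub_proj_mem_domain b u⟩ with hg
  have hsum : u = f + g := Subtype.ext (by simp [hf, hg])
  have h := hE.inner_eq u
  rw [E.measure_eq_add b u, integral_add_measure (hE.integrable_id f.2) (hE.integrable_id g.2),
    ← hE.inner_eq f, ← hE.inner_eq g] at h
  conv_lhs at h => rw [hsum]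
  rw [LinearPMap.map_add, Submodule.coe_add, inner_add_left, inner_add_right, inner_add_right] at h
  have hs : ⟪H g, (f : V)⟫ = ⟪H f, (g : V)⟫ := by rw [hH g f, real_inner_comm]
  change ⟪H f, (g : V)⟫ = 0
  linarith

theorem inner_map_proj_sub_proj (hE : E.IsResolutionOf H) (hH : H.IsFormalAdjoint H) (b : ℝ)
    (u v : H.domain) :
    ⟪H ⟨E.proj b u, hE.proj_mem_domain b u⟩, (v : V) - E.proj b v⟫ = 0 := by
  set f : H.domain := ⟨E.proj b u, hE.proj_mem_domain b u⟩ with hf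
  set g : H.domain := ⟨(v : V) - E.proj b v, hE.sub_proj_mem_domain b v⟩ with hg
  -- Polarization: `E(b)` sends `f + g` to `f`, so the diagonal case already pairs independent `u`
  -- and `v`.
  have h := hE.inner_proj_sub_proj_self hH b (f + g)
  have e1 : E.proj b ((f + g : H.domain) : V) = f := by
    simp [hf, hg, E.idem]
  have e2 : (⟨E.proj b ((f + g : H.domain) : V), hE.proj_mem_domain b _⟩ : H.domain) = f :=
    Subtype.ext e1
  rw [e2, e1, Submodule.coe_add, add_sub_cancel_left] at h
  exact h

/-- Paired with `v` in the dense domain, both sides equal `(H E(b)u, E(b)v)`. -/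
theorem map_proj (hE : E.IsResolutionOf H) (hH : H.IsFormalAdjoint H) (b : ℝ) (u : H.domain) :
    H ⟨E.proj b u, hE.proj_mem_domain b u⟩ = E.proj b (H u) := by
  refine hE.dense_domain.eq_of_inner_left (𝕜 := ℝ) fun v hv => ?_
  have h1 := hE.inner_map_proj_sub_proj hH b u ⟨v, hv⟩
  have h2 := hE.inner_map_proj_sub_proj hH b ⟨v, hv⟩ u
  rw [inner_sub_right, sub_eq_zero] at h1
  have hs := hH u ⟨E.proj b v, hE.proj_mem_domain b v⟩
  have hs' := hH ⟨E.proj b u, hE.proj_mem_domain b u⟩ ⟨E.proj b v, hE.proj_mem_domain b v⟩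
  rw [inner_sub_right, sub_eq_zero] at h2
  simp only at h1 h2 hs hs'
  rw [h1, E.symm, hs, hs', real_inner_comm, ← h2, real_inner_comm]

end IsResolutionOf

end SpectralFamily

/-! ### Local boundedness and continuity of semigroup orbits. -/

/-- A strongly continuous semigroup `(P_t)_{t ≥ 0}` of bounded operators. -/
structure IsStronglyContinuousSemigroup {V : Type*} [NormedAddCommGroup V] [NormedSpace ℝ V]
    (P : ℝ → V →L[ℝ] V) : Prop where
  zero : ∀ f, P 0 f = f
  add : ∀ s t, 0 ≤ s → 0 ≤ t → ∀ f, P (s + t) f = P s (P t f)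
  strong_cont : ∀ f, Tendsto (fun t => P t f) (𝓝[>] 0) (𝓝 f)

theorem IsMarkovSemigroup.isStronglyContinuousSemigroup {M : Type*} [MeasurableSpace M]
    {μ : Measure M} {P : ℝ → Lp ℝ 2 μ →L[ℝ] Lp ℝ 2 μ} (hP : IsMarkovSemigroup μ P) :
    IsStronglyContinuousSemigroup P :=
  ⟨hP.zero, hP.add, hP.strong_cont⟩

namespace IsStronglyContinuousSemigroup

variable {V : Type*} [NormedAddCommGroup V] [NormedSpace ℝ V] {P : ℝ → V →L[ℝ] V}

theorem exists_norm_le_near_zero [CompleteSpace V] (hP : IsStronglyContinuousSemigroup P) :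
    ∃ δ > 0, ∃ C : ℝ, ∀ t ∈ Icc 0 δ, ‖P t‖ ≤ C := by
  by_contra! h
  -- The maximum with `‖P 0‖` excludes `t = 0`, so the times approach `0` from the right, where
  -- strong continuity applies.
  have h' : ∀ n : ℕ, ∃ t ∈ Icc (0 : ℝ) (1 / ((n : ℝ) + 1)), max (n : ℝ) ‖P 0‖ < ‖P t‖ := fun n =>
    h _ (by positivity) _
  choose t ht htn using h'
  have hpos : ∀ n, 0 < t n := fun n => by
    refine (ht n).1.lt_of_ne fun h0 => ?_
    have := (le_max_right (n : ℝ) ‖P 0‖).trans_lt (htn n)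
    rw [← h0] at this
    exact lt_irrefl _ this
  have hlim : Tendsto t atTop (𝓝[>] 0) := by
    refine tendsto_nhdsWithin_iff.2 ⟨?_, Eventually.of_forall hpos⟩
    exact squeeze_zero (fun n => (ht n).1) (fun n => (ht n).2)
      tendsto_one_div_add_atTop_nhds_zero_nat
  obtain ⟨C, hC⟩ := banach_steinhaus (g := fun n => P (t n)) fun f => by
    obtain ⟨C, hC⟩ := ((hP.strong_cont f).comp hlim).norm.bddAbove_range
    exact ⟨C, fun n => hC ⟨n, rfl⟩⟩
  obtain ⟨n, hn⟩ := exists_nat_gt C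
  exact absurd (hC n) (not_le.2 ((hn.trans_le (le_max_left _ _)).trans (htn n)))

theorem exists_norm_le [CompleteSpace V] (hP : IsStronglyContinuousSemigroup P) (T : ℝ) :
    ∃ C : ℝ, ∀ t ∈ Icc 0 T, ‖P t‖ ≤ C := by
  obtain ⟨δ, hδ, C, hC⟩ := hP.exists_norm_le_near_zero
  have key : ∀ n : ℕ, ∃ D : ℝ, ∀ t ∈ Icc 0 (n * δ), ‖P t‖ ≤ D := by
    intro n
    induction n with
    | zero =>
      refine ⟨C, fun t ht => hC t ⟨ht.1, ?_⟩⟩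
      have := ht.2
      simp only [Nat.cast_zero, zero_mul] at this
      linarith
    | succ n ih =>
      obtain ⟨D, hD⟩ := ih
      refine ⟨max C (C * D), fun t ht => ?_⟩
      rcases le_total t δ with h | h
      · exact (hC t ⟨ht.1, h⟩).trans (le_max_left _ _)
      · refine le_trans ?_ (le_max_right _ _)
        have h2 : t - δ ∈ Icc 0 (n * δ) := by
          have := ht.2
          push_cast at this
          constructor <;> linarith
        have hC0 := hC δ ⟨hδ.le, le_rfl⟩
        have e : P t = (P δ).comp (P (t - δ)) := by
          ext f
          rw [ContinuousLinearMap.comp_apply, ← hP.add _ _ hδ.le h2.1, add_sub_cancel]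
        rw [e]
        exact ((P δ).opNorm_comp_le _).trans
          (mul_le_mul hC0 (hD _ h2) (norm_nonneg _) ((norm_nonneg _).trans hC0))
  obtain ⟨n, hn⟩ := exists_nat_ge (T / δ)
  obtain ⟨D, hD⟩ := key n
  exact ⟨D, fun t ht => hD t ⟨ht.1, ht.2.trans ((div_le_iff₀ hδ).1 hn)⟩⟩

theorem tendsto_abs (hP : IsStronglyContinuousSemigroup P) (f : V) :
    Tendsto (fun t => P |t| f) (𝓝 0) (𝓝 f) := by
  have h1 : Tendsto (fun t => P t f) (𝓝[≥] 0) (𝓝 f) := by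
    rw [← Ioi_insert, nhdsWithin_insert, tendsto_sup]
    refine ⟨?_, hP.strong_cont f⟩
    rw [tendsto_pure_left]
    intro s hs
    rw [hP.zero]
    exact mem_of_mem_nhds hs
  refine h1.comp (tendsto_nhdsWithin_iff.2 ⟨?_, Eventually.of_forall fun t => abs_nonneg t⟩)
  simpa using (continuous_abs (G := ℝ)).tendsto 0

/-- Factoring out the smaller time reduces two-sided continuity to right continuity at `0`. -/
theorem norm_sub_le (hP : IsStronglyContinuousSemigroup P) {s t C : ℝ} (hs : 0 ≤ s) (ht : 0 ≤ t)
    (hsC : ‖P s‖ ≤ C) (htC : ‖P t‖ ≤ C) (f : V) :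
    ‖P s f - P t f‖ ≤ C * ‖P |s - t| f - f‖ := by
  wlog hst : t ≤ s generalizing s t
  · rw [norm_sub_rev, abs_sub_comm]
    exact this ht hs htC hsC (le_of_not_ge hst)
  rw [abs_of_nonneg (sub_nonneg.2 hst)]
  have : P s f = P t (P (s - t) f) := by
    rw [← hP.add _ _ ht (sub_nonneg.2 hst), add_sub_cancel]
  rw [this, ← map_sub]
  exact (P t).le_of_opNorm_le htC _

theorem continuousOn [CompleteSpace V] (hP : IsStronglyContinuousSemigroup P) (f : V) (T : ℝ) :
    ContinuousOn (fun t => P t f) (Icc 0 T) := by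
  obtain ⟨C, hC⟩ := hP.exists_norm_le T
  intro t ht
  have h0 : Tendsto (fun s => C * ‖P |s - t| f - f‖) (𝓝[Icc 0 T] t) (𝓝 0) := by
    have h1 : Tendsto (fun s : ℝ => s - t) (𝓝[Icc 0 T] t) (𝓝 0) :=
      ((continuous_id.sub continuous_const).tendsto' t 0 (sub_self t)).mono_left nhdsWithin_le_nhds
    have h2 := (((hP.tendsto_abs f).comp h1).sub_const f).norm.const_mul C
    simpa using h2
  refine tendsto_iff_norm_sub_tendsto_zero.2 (squeeze_zero' (Eventually.of_forall fun s =>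
    norm_nonneg _) ?_ h0)
  filter_upwards [self_mem_nhdsWithin] with s hs
  exact hP.norm_sub_le hs.1 ht.1 (hC s hs) (hC t ht) f

end IsStronglyContinuousSemigroup

/-! ### Energy dissipation, contractivity and commutation with the semigroup. -/

theorem norm_le_of_inner_deriv_right_nonpos {V : Type*} [NormedAddCommGroup V]
    [InnerProductSpace ℝ V] {f f' : ℝ → V} {a b : ℝ} (hab : a ≤ b)
    (hcont : ContinuousOn f (Icc a b))
    (hderiv : ∀ x ∈ Ioo a b, HasDerivWithinAt f (f' x) (Ioi x) x)
    (hle : ∀ x ∈ Ioo a b, ⟪f' x, f x⟫ ≤ 0) : ‖f b‖ ≤ ‖f a‖ := by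
  have h := intervalIntegral.sub_le_integral_of_hasDeriv_right_of_le (φ := fun _ => (0 : ℝ)) hab
    (hcont.norm.pow 2) (fun x hx => (hderiv x hx).norm_sq) integrableOn_zero fun x hx => by
      have := hle x hx
      rw [real_inner_comm] at this
      linarith
  rw [intervalIntegral.integral_zero, sub_nonpos] at h
  exact (pow_le_pow_iff_left₀ (norm_nonneg _) (norm_nonneg _) two_ne_zero).1 h

namespace IsNegGenerator

variable {V : Type*} [NormedAddCommGroup V] [InnerProductSpace ℝ V] {H : V →ₗ.[ℝ] V}
  {P : ℝ → V →L[ℝ] V}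

theorem tendsto (hHP : IsNegGenerator H P) (u : H.domain) :
    Tendsto (fun t : ℝ => t⁻¹ • (P t u - u)) (𝓝[>] 0) (𝓝 (-H u)) :=
  (hHP u (H u)).1 (H.mem_graph u)

theorem exists_map_eq (hHP : IsNegGenerator H P) (hP : IsStronglyContinuousSemigroup P)
    (u : H.domain) {t : ℝ} (ht : 0 ≤ t) : ∃ w : H.domain, (w : V) = P t u ∧ H w = P t (H u) := by
  have h : (P t u, P t (H u)) ∈ H.graph := by
    rw [hHP]
    have := ((P t).continuous.tendsto _).comp (hHP.tendsto u)
    rw [map_neg] at this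
    refine this.congr' ?_
    filter_upwards [self_mem_nhdsWithin] with s hs
    simp only [Function.comp_apply, map_smul, map_sub]
    rw [← hP.add t s ht (le_of_lt hs), add_comm, hP.add s t (le_of_lt hs) ht]
  exact (LinearPMap.mem_graph_iff H).1 h

theorem hasDerivWithinAt (hHP : IsNegGenerator H P) (hP : IsStronglyContinuousSemigroup P)
    (u : H.domain) {t : ℝ} (ht : 0 ≤ t) :
    HasDerivWithinAt (fun s => P s u) (-P t (H u)) (Ioi t) t := by
  rw [hasDerivWithinAt_iff_tendsto_slope' self_notMem_Ioi]
  have h1 : Tendsto (fun s : ℝ => s - t) (𝓝[>] t) (𝓝[>] 0) := by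
    refine tendsto_nhdsWithin_iff.2 ⟨?_, ?_⟩
    · exact ((continuous_id.sub continuous_const).tendsto' t 0 (sub_self t)).mono_left
        nhdsWithin_le_nhds
    · filter_upwards [self_mem_nhdsWithin] with s hs
      exact sub_pos.2 (mem_Ioi.1 hs)
  have := ((P t).continuous.tendsto _).comp ((hHP.tendsto u).comp h1)
  rw [map_neg] at this
  refine this.congr' ?_
  filter_upwards [self_mem_nhdsWithin] with s hs
  simp only [Function.comp_apply, map_smul, map_sub, slope_def_module]
  rw [← hP.add t (s - t) ht (sub_pos.2 hs).le, add_sub_cancel]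

variable [CompleteSpace V] {E : SpectralFamily V}

theorem norm_apply_le_of_mem_domain (hHP : IsNegGenerator H P)
    (hP : IsStronglyContinuousSemigroup P) (hE : E.IsResolutionOf H) (u : H.domain) {s t : ℝ}
    (hs : 0 ≤ s) (hst : s ≤ t) : ‖P t u‖ ≤ ‖P s u‖ := by
  refine norm_le_of_inner_deriv_right_nonpos (f := fun r => P r u) (f' := fun r => -P r (H u)) hst
    ((hP.continuousOn (u : V) t).mono (Icc_subset_Icc_left hs))
    (fun x hx => hHP.hasDerivWithinAt hP u (hs.trans hx.1.le)) fun x hx => ?_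
  obtain ⟨w, hw, hHw⟩ := hHP.exists_map_eq hP u (hs.trans hx.1.le)
  rw [← hw, ← hHw, inner_neg_left]
  exact neg_nonpos.2 (hE.inner_nonneg w)

theorem norm_apply_le (hHP : IsNegGenerator H P) (hP : IsStronglyContinuousSemigroup P)
    (hE : E.IsResolutionOf H) (u : V) {t : ℝ} (ht : 0 ≤ t) : ‖P t u‖ ≤ ‖u‖ := by
  refine hE.dense_domain.induction (P := fun u => ‖P t u‖ ≤ ‖u‖) (fun v hv => ?_)
    (isClosed_le (P t).continuous.norm continuous_norm) u
  have := hHP.norm_apply_le_of_mem_domain hP hE ⟨v, hv⟩ le_rfl ht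
  simpa [hP.zero] using this

/-- For `v` in the domain, the difference `d` of the two sides solves `d' = -Hd` with `d(0) = 0`;
since `H ≥ 0`, its norm cannot grow. Density does the rest. -/
theorem proj_apply (hHP : IsNegGenerator H P) (hP : IsStronglyContinuousSemigroup P)
    (hE : E.IsResolutionOf H) (hH : H.IsFormalAdjoint H) (b : ℝ) (u : V) {t : ℝ} (ht : 0 ≤ t) :
    E.proj b (P t u) = P t (E.proj b u) := by
  refine hE.dense_domain.induction (P := fun u => E.proj b (P t u) = P t (E.proj b u))
    (fun v hv => ?_) (isClosed_eq (by fun_prop) (by fun_prop)) u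
  lift v to H.domain using hv
  set v' : H.domain := ⟨E.proj b v, hE.proj_mem_domain b v⟩ with hv'
  have h := norm_le_of_inner_deriv_right_nonpos (f := fun r => E.proj b (P r v) - P r v')
    (f' := fun r => E.proj b (-P r (H v)) - -P r (H v')) ht
    (((E.proj b).continuous.comp_continuousOn (hP.continuousOn (v : V) t)).sub
      (hP.continuousOn (v' : V) t))
    (fun x hx => ((E.proj b).hasFDerivAt.comp_hasDerivWithinAt x
      (hHP.hasDerivWithinAt hP v hx.1.le)).sub (hHP.hasDerivWithinAt hP v' hx.1.le))
    fun x hx => by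
      obtain ⟨w, hw, hHw⟩ := hHP.exists_map_eq hP v hx.1.le
      obtain ⟨w', hw', hHw'⟩ := hHP.exists_map_eq hP v' hx.1.le
      rw [← hw, ← hw', ← hHw, ← hHw', map_neg, ← hE.map_proj hH b w]
      have := hE.inner_nonneg (⟨E.proj b w, hE.proj_mem_domain b w⟩ - w')
      rw [LinearPMap.map_sub, Submodule.coe_sub] at this
      rw [sub_neg_eq_add, neg_add_eq_sub, ← neg_sub, inner_neg_left]
      linarith
  simp only [hP.zero, hv', sub_self, norm_zero, norm_le_zero_iff] at h
  exact sub_eq_zero.1 h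

end IsNegGenerator

/-! ### The Nash inequality and the differential inequality. -/

/-- An optimal choice of the threshold `b` turns the family of bounds
`b (φ - C₁/(1+α) b^(1+α) B) ≤ e` into a Nash type inequality. -/
theorem nash_of_forall_threshold {α C₁ r K φ B e : ℝ} (hα : -1 < α) (hC₁ : 0 < C₁) (hr : 0 < r)
    (hK : 0 < K) (hφ : 0 < φ) (hB : 0 < B)
    (hKr : K * φ ≤ C₁ / (1 + α) * r ^ (1 + α) * B)
    (h : ∀ b ∈ Ioo 0 r, b * (φ - C₁ / (1 + α) * b ^ (1 + α) * B) ≤ e) :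
    (1 - K) * K ^ (1 / (1 + α)) * ((1 + α) / C₁) ^ (1 / (1 + α)) * B ^ (-1 / (1 + α)) *
      φ ^ (1 + 1 / (1 + α)) ≤ e := by
  have ha : 0 < 1 + α := by linarith
  -- `x` is the value of `b^(1+α)` at which the subtracted term equals `K φ`.
  set x : ℝ := K * ((1 + α) / C₁) * φ * B⁻¹ with hx
  have hx0 : 0 < x := by positivity
  set l : ℝ := x ^ (1 / (1 + α)) with hl
  have hl0 : 0 < l := Real.rpow_pos_of_pos hx0 _
  have hla : l ^ (1 + α) = x := by
    rw [hl, ← Real.rpow_mul hx0.le, one_div_mul_cancel ha.ne', Real.rpow_one]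
  have hlr : l ≤ r := by
    refine (Real.rpow_le_rpow_iff hl0.le hr.le ha).1 ?_
    rw [hla]
    calc x = (K * φ) * ((1 + α) / C₁ * B⁻¹) := by rw [hx]; ring
      _ ≤ (C₁ / (1 + α) * r ^ (1 + α) * B) * ((1 + α) / C₁ * B⁻¹) := by gcongr
      _ = r ^ (1 + α) := by field_simp
  -- `l = r` is possible, while `h` covers only `b < r`: pass to the limit from the left.
  have hlim : l * (φ - C₁ / (1 + α) * l ^ (1 + α) * B) ≤ e := by
    have hc : ContinuousAt (fun b : ℝ => b * (φ - C₁ / (1 + α) * b ^ (1 + α) * B)) l := by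
      have : ContinuousAt (fun b : ℝ => b ^ (1 + α)) l :=
        Real.continuousAt_rpow_const _ _ (Or.inl hl0.ne')
      fun_prop
    refine le_of_tendsto (hc.tendsto.mono_left (nhdsWithin_le_nhds (s := Iio l))) ?_
    filter_upwards [Ioo_mem_nhdsLT hl0] with b hb
    exact h b ⟨hb.1, hb.2.trans_le hlr⟩
  have hxB : C₁ / (1 + α) * x * B = K * φ := by
    rw [hx]; field_simp
  rw [hla, hxB] at hlim
  refine le_of_eq_of_le ?_ hlim
  rw [hl, hx, Real.mul_rpow (by positivity) (by positivity),
    Real.mul_rpow (by positivity) (by positivity), Real.mul_rpow (by positivity) (by positivity),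
    Real.inv_rpow hB.le, ← Real.rpow_neg hB.le, neg_div, Real.rpow_add hφ, Real.rpow_one]
  ring

/-- A differential inequality `φ' ≤ -2 A w φ^(1+1/(1+α))` integrates to polynomial decay. -/
theorem le_rpow_of_deriv_right_le {α A T : ℝ} {φ φ' w : ℝ → ℝ} (hα : -1 < α) (hT : 0 ≤ T)
    (hφ : ∀ s ∈ Icc 0 T, 0 < φ s) (hcont : ContinuousOn φ (Icc 0 T))
    (hderiv : ∀ s ∈ Ioo 0 T, HasDerivWithinAt φ (φ' s) (Ioi s) s)
    (hw : IntegrableOn w (Icc 0 T))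
    (hle : ∀ s ∈ Ioo 0 T, φ' s ≤ -2 * (A * w s * φ s ^ (1 + 1 / (1 + α))))
    (hpos : 0 < φ 0 ^ (-1 / (1 + α)) + 2 * A * (1 / (1 + α)) * ∫ s in (0 : ℝ)..T, w s) :
    φ T ≤ (φ 0 ^ (-1 / (1 + α)) + 2 * A * (1 / (1 + α)) * ∫ s in (0 : ℝ)..T, w s) ^
      (-(1 + α)) := by
  have ha : 0 < 1 + α := by linarith
  have hT' : T ∈ Icc 0 T := ⟨hT, le_rfl⟩
  have key := intervalIntegral.integral_le_sub_of_hasDeriv_right_of_le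
    (g := fun s => φ s ^ (-1 / (1 + α))) (φ := fun s => 2 * A * (1 / (1 + α)) * w s) hT
    (hcont.rpow_const fun s hs => Or.inl (hφ s hs).ne')
    (fun s hs => (hderiv s hs).rpow_const (Or.inl (hφ s (Ioo_subset_Icc_self hs)).ne'))
    (hw.const_mul _) fun s hs => by
      have h0 := hφ s (Ioo_subset_Icc_self hs)
      have h1 : 0 ≤ (1 / (1 + α)) * φ s ^ (-1 / (1 + α) - 1) := by positivity
      have h2 := mul_le_mul_of_nonneg_right (hle s hs) h1
      -- The power of `φ` produced by differentiating `φ^(-1/(1+α))` cancels the one in the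
      -- inequality, leaving a multiple of `w`.
      have h3 : φ s ^ (1 + 1 / (1 + α)) * φ s ^ (-1 / (1 + α) - 1) = 1 := by
        rw [← Real.rpow_add h0, neg_div]
        ring_nf
        exact Real.rpow_zero _
      have h4 : -2 * (A * w s * φ s ^ (1 + 1 / (1 + α))) *
          ((1 / (1 + α)) * φ s ^ (-1 / (1 + α) - 1)) = -(2 * A * (1 / (1 + α)) * w s) := by
        linear_combination (-2 * A * w s * (1 / (1 + α))) * h3
      rw [h4] at h2
      rw [neg_div] at h2 ⊢
      linarith
  rw [intervalIntegral.integral_const_mul] at key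
  have hle' : φ 0 ^ (-1 / (1 + α)) + 2 * A * (1 / (1 + α)) * ∫ s in (0 : ℝ)..T, w s ≤
      φ T ^ (-1 / (1 + α)) := by linarith
  calc φ T = (φ T ^ (-1 / (1 + α))) ^ (-(1 + α)) := by
        rw [← Real.rpow_mul (hφ T hT').le, div_mul_eq_mul_div, neg_one_mul, neg_neg,
          div_self ha.ne', Real.rpow_one]
    _ ≤ _ := Real.rpow_le_rpow_of_nonpos hpos hle' (by linarith)

/-! ### Integrability and growth of the weight. -/

section Weight

variable {m C β q : ℝ}

theorem weight_le_rpow (hm : 0 < m) (hC : 0 ≤ C) (hq : q ≤ 0) {s : ℝ} (hs : 0 ≤ s) :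
    (m + C * s ^ β) ^ q ≤ m ^ q :=
  Real.rpow_le_rpow_of_nonpos hm (le_add_of_nonneg_right (by positivity)) hq

theorem integrableOn_weight (hm : 0 < m) (hC : 0 ≤ C) (hq : q ≤ 0) (t : ℝ) :
    IntegrableOn (fun s : ℝ => (m + C * s ^ β) ^ q) (Icc 0 t) := by
  have hmeas : Measurable fun s : ℝ => (m + C * s ^ β) ^ q := by fun_prop
  refine Integrable.mono' (integrable_const (m ^ q)) hmeas.aestronglyMeasurable ?_
  filter_upwards [ae_restrict_mem measurableSet_Icc] with s hs
  have : 0 ≤ C * s ^ β := mul_nonneg hC (Real.rpow_nonneg hs.1 _)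
  rw [Real.norm_of_nonneg (by positivity)]
  exact weight_le_rpow hm hC hq hs.1

theorem integral_weight_nonneg (hm : 0 < m) (hC : 0 ≤ C) {t : ℝ} (ht : 0 ≤ t) :
    0 ≤ ∫ s in (0 : ℝ)..t, (m + C * s ^ β) ^ q :=
  intervalIntegral.integral_nonneg ht fun s hs => by
    have : 0 ≤ C * s ^ β := mul_nonneg hC (Real.rpow_nonneg hs.1 _)
    positivity

/-- On `[1, t]` one has `m + C s^β ≤ (m + C) s^γ`, and `q ≤ 0` reverses this; the part over `[0, 1]`
is dropped. -/
theorem integral_rpow_le_integral_weight {γ : ℝ} (hm : 0 < m) (hC : 0 ≤ C) (hq : q ≤ 0)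
    (hγ : 0 ≤ γ) (hβγ : C = 0 ∨ β ≤ γ) {t : ℝ} (ht : 1 ≤ t) :
    (m + C) ^ q * ∫ s in (1 : ℝ)..t, s ^ (γ * q) ≤ ∫ s in (0 : ℝ)..t, (m + C * s ^ β) ^ q := by
  have hint := integrableOn_weight (β := β) hm hC hq t
  have hii : ∀ a b : ℝ, a ∈ Icc 0 t → b ∈ Icc 0 t →
      IntervalIntegrable (fun s : ℝ => (m + C * s ^ β) ^ q) volume a b := fun a b ha hb =>
    (hint.mono_set (uIcc_subset_Icc ha hb)).intervalIntegrable
  have h0 : (0 : ℝ) ∈ Icc 0 t := ⟨le_rfl, by linarith⟩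
  have h1 : (1 : ℝ) ∈ Icc 0 t := ⟨zero_le_one, ht⟩
  have htt : t ∈ Icc 0 t := ⟨by linarith, le_rfl⟩
  rw [← intervalIntegral.integral_add_adjacent_intervals (hii 0 1 h0 h1) (hii 1 t h1 htt),
    ← intervalIntegral.integral_const_mul]
  refine le_add_of_nonneg_of_le (integral_weight_nonneg hm hC zero_le_one) ?_
  refine intervalIntegral.integral_mono_on ht ?_ (hii 1 t h1 htt) fun s hs => ?_
  · refine (intervalIntegral.intervalIntegrable_rpow (Or.inr ?_)).const_mul _
    rw [uIcc_of_le ht]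
    exact fun h => absurd h.1 (by norm_num)
  · have hs0 : 0 < s := by linarith [hs.1]
    rw [Real.rpow_mul hs0.le, ← Real.mul_rpow (by positivity) (by positivity)]
    refine Real.rpow_le_rpow_of_nonpos (by positivity) ?_ hq
    have hone : 1 ≤ s ^ γ := Real.one_le_rpow hs.1 hγ
    have hC' : C * s ^ β ≤ C * s ^ γ := by
      rcases hβγ with h | h
      · simp [h]
      · exact mul_le_mul_of_nonneg_left (Real.rpow_le_rpow_of_exponent_le hs.1 h) hC
    nlinarith

/-- The integrand is at least its value at `t`, and `t - 1 ≥ t / 2`. -/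
theorem half_mul_rpow_le_integral_rpow {κ t : ℝ} (hκ : κ ≤ 0) (ht : 2 ≤ t) :
    1 / 2 * t ^ (1 + κ) ≤ ∫ s in (1 : ℝ)..t, s ^ κ := by
  have ht0 : 0 < t := by linarith
  have h : ∫ _ in (1 : ℝ)..t, t ^ κ ≤ ∫ s in (1 : ℝ)..t, s ^ κ := by
    refine intervalIntegral.integral_mono_on (by linarith) intervalIntegrable_const ?_
      fun s hs => Real.rpow_le_rpow_of_nonpos (by linarith [hs.1]) hs.2 hκ
    refine intervalIntegral.intervalIntegrable_rpow (Or.inr ?_)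
    rw [uIcc_of_le (by linarith)]
    exact fun h => absurd h.1 (by norm_num)
  rw [intervalIntegral.integral_const, smul_eq_mul] at h
  refine le_trans ?_ h
  rw [Real.rpow_add ht0, Real.rpow_one, ← mul_assoc]
  exact mul_le_mul_of_nonneg_right (by linarith) (by positivity)

end Weight

theorem isBigO_rpow_neg_of_le {f g h : ℝ → ℝ} {a c : ℝ} (ha : 0 ≤ a) (hc : 0 < c)
    (hf : ∀ᶠ t in atTop, 0 ≤ f t) (hfh : ∀ᶠ t in atTop, f t ≤ h t ^ (-a))
    (hg : ∀ᶠ t in atTop, 0 < g t) (hgh : ∀ᶠ t in atTop, c * g t ≤ h t) :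
    f =O[atTop] fun t => g t ^ (-a) := by
  refine IsBigO.of_bound (c ^ (-a)) ?_
  filter_upwards [hf, hfh, hg, hgh] with t h1 h2 h3 h4
  rw [Real.norm_of_nonneg h1, Real.norm_of_nonneg (by positivity), ← Real.mul_rpow hc.le h3.le]
  exact h2.trans (Real.rpow_le_rpow_of_nonpos (by positivity) h4 (by linarith))

/-! ### Decay of the variance from the density of states. -/

section DensityOfStates

variable {V : Type*} [NormedAddCommGroup V] [InnerProductSpace ℝ V] {E : SpectralFamily V}
  {X : Submodule ℝ V} {N : Seminorm ℝ X} {r C₁ α : ℝ}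

namespace SpectralFamily

theorem norm_proj_sub_proj_zero_sq (E : SpectralFamily V) {b : ℝ} (hb : 0 ≤ b) (u : V) :
    ‖E.proj b u - E.proj 0 u‖ ^ 2 = ‖E.proj b u‖ ^ 2 - ‖E.proj 0 u‖ ^ 2 := by
  have := E.norm_sq_sub_proj 0 (E.proj b u)
  rwa [E.nested 0 b hb] at this

theorem norm_proj_sub_proj_zero_sq_le_variance (E : SpectralFamily V) (b : ℝ) (u : V)
    (hb : 0 ≤ b) : ‖E.proj b u - E.proj 0 u‖ ^ 2 ≤ E.variance u := by
  have : E.proj b u - E.proj 0 u = E.proj b (u - E.proj 0 u) := by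
    rw [map_sub, E.proj_proj_of_le hb]
  rw [this, variance]
  exact pow_le_pow_left₀ (norm_nonneg _) (E.norm_proj_le _ _) 2

theorem variance_nonneg (E : SpectralFamily V) (u : V) : 0 ≤ E.variance u := sq_nonneg _

end SpectralFamily

namespace DensityOfStatesBound

theorem norm_sq_proj_sub_proj_zero_le (hX : DensityOfStatesBound E X N r C₁ α) (z : X) {b : ℝ}
    (hb : b ∈ Ioo 0 r) :
    ‖E.proj b z - E.proj 0 z‖ ^ 2 ≤ C₁ / (1 + α) * b ^ (1 + α) * N z ^ 2 := by
  have ha : 0 < 1 + α := by linarith [hX.neg_one_lt]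
  -- Right continuity at `0` lets the integration start at `E(0)`, so no atom at `0` is counted; `α
  -- > -1` makes the bound integrable there.
  have hcont : ContinuousOn (fun s => ⟪E.proj s (z : V), (z : V)⟫) (Icc 0 b) := by
    intro s hs
    rcases hs.1.eq_or_lt with h | h
    · subst h
      exact ((E.right_cont 0 (z : V)).inner continuousWithinAt_const).mono Icc_subset_Ici_self
    · exact (hX.differentiable z z s ⟨h, hs.2.trans_lt hb.2⟩).continuousAt.continuousWithinAt
  have hint : IntervalIntegrable (fun s : ℝ => C₁ * N z * N z * s ^ α) volume 0 b :=
    (intervalIntegral.intervalIntegrable_rpow' hX.neg_one_lt).const_mul _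
  have h := intervalIntegral.sub_le_integral_of_hasDeriv_right_of_le hb.1.le hcont
    (fun s hs => (hX.differentiable z z s
      ⟨hs.1, hs.2.trans hb.2⟩).hasDerivAt.hasDerivWithinAt)
    ((intervalIntegrable_iff_integrableOn_Icc_of_le hb.1.le).1 hint) fun s hs => by
      have := (le_abs_self _).trans (hX.deriv_bound z z s ⟨hs.1, hs.2.trans hb.2⟩)
      linarith
  rw [intervalIntegral.integral_const_mul, integral_rpow (Or.inl hX.neg_one_lt),
    E.inner_proj_self, E.inner_proj_self, add_comm α 1, Real.zero_rpow ha.ne', sub_zero] at h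
  rw [E.norm_proj_sub_proj_zero_sq hb.1.le]
  refine h.trans (le_of_eq ?_)
  ring

/-- The cutoff `w` need not lie in `X`. Its low-frequency part is `E(R)` applied to that of `z`,
hence no larger, so the norm of `z` suffices. -/
theorem mul_norm_sq_sub_le_inner (hX : DensityOfStatesBound E X N r C₁ α) {H : V →ₗ.[ℝ] V}
    (hE : E.IsResolutionOf H) {R B : ℝ} (hR : 0 ≤ R) (z : X) (hB : N z ^ 2 ≤ B) (w : H.domain)
    (hw : (w : V) = E.proj R z - E.proj 0 z) {b : ℝ} (hb : b ∈ Ioo 0 r) :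
    b * (‖(w : V)‖ ^ 2 - C₁ / (1 + α) * b ^ (1 + α) * B) ≤ ⟪H w, (w : V)⟫ := by
  have ha : 0 < 1 + α := by linarith [hX.neg_one_lt]
  have hC := hX.C₁_pos
  have hb0 : 0 < b := hb.1
  have h1 : E.proj b (w : V) = E.proj R (E.proj b z - E.proj 0 z) := by
    rw [hw, map_sub, map_sub, E.proj_comm R b, E.proj_proj_of_le hb.1.le, E.proj_proj_of_le hR]
  have h2 : ‖E.proj b (w : V)‖ ^ 2 ≤ C₁ / (1 + α) * b ^ (1 + α) * B := by
    rw [h1]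
    refine (pow_le_pow_left₀ (norm_nonneg _) (E.norm_proj_le _ _) 2).trans ?_
    refine (hX.norm_sq_proj_sub_proj_zero_le z hb).trans ?_
    exact mul_le_mul_of_nonneg_left hB (by positivity)
  refine le_trans ?_ (hE.mul_norm_sq_sub_proj_le w b)
  rw [E.norm_sq_sub_proj]
  exact mul_le_mul_of_nonneg_left (by linarith) hb.1.le

end DensityOfStatesBound

theorem decayConstant_pos {K : ℝ} (hα : -1 < α) (hC₁ : 0 < C₁) (hK : 0 < K) (hK1 : K < 1) :
    0 < decayConstant α C₁ K := by
  have ha : 0 < 1 + α := by linarith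
  have : 0 < 1 - K := by linarith
  unfold decayConstant
  positivity

namespace IsNegGenerator

variable [CompleteSpace V] {H : V →ₗ.[ℝ] V} {P : ℝ → V →L[ℝ] V}

theorem variance_apply_le (hHP : IsNegGenerator H P) (hP : IsStronglyContinuousSemigroup P)
    (hE : E.IsResolutionOf H) (hH : H.IsFormalAdjoint H) (u : V) {t : ℝ} (ht : 0 ≤ t) :
    E.variance (P t u) ≤ E.variance u := by
  rw [SpectralFamily.variance, SpectralFamily.variance, hHP.proj_apply hP hE hH 0 u ht, ← map_sub]
  exact pow_le_pow_left₀ (norm_nonneg _) (hHP.norm_apply_le hP hE _ ht) 2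

variable {u : X} {C₂ β K t : ℝ}

theorem norm_sq_apply_spectral_cutoff_le (hHP : IsNegGenerator H P)
    (hP : IsStronglyContinuousSemigroup P) (hE : E.IsResolutionOf H) (hH : H.IsFormalAdjoint H)
    (hX : DensityOfStatesBound E X N r C₁ α) (hC₂ : 0 ≤ C₂)
    (hPu : ∀ t : ℝ, 0 ≤ t → ∃ h : P t (u : V) ∈ X,
      N ⟨P t (u : V), h⟩ ^ 2 ≤ N u ^ 2 + C₂ * t ^ β)
    (hNu : 0 < N u) (hvar : 0 < E.variance (u : V)) (hK : 0 < K) (hK1 : K < 1)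
    (hKr : K * E.variance (u : V) ≤ C₁ / (1 + α) * r ^ (1 + α) * N u ^ 2) (ht : 0 ≤ t)
    {R : ℝ} (hR : 0 ≤ R) :
    ‖P t (E.proj R u - E.proj 0 u)‖ ^ 2 ≤
      (E.variance (u : V) ^ (-1 / (1 + α)) + decayConstant α C₁ K *
        ∫ s in (0 : ℝ)..t, (N u ^ 2 + C₂ * s ^ β) ^ (-1 / (1 + α))) ^ (-(1 + α)) := by
  have hα := hX.neg_one_lt
  have ha : 0 < 1 + α := by linarith
  have hC₁ := hX.C₁_pos
  have hr := hX.r_pos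
  have hq : -1 / (1 + α) ≤ 0 := div_nonpos_of_nonpos_of_nonneg (by norm_num) ha.le
  have hm : 0 < N u ^ 2 := by positivity
  have hI := integral_weight_nonneg (β := β) (q := -1 / (1 + α)) hm hC₂ ht
  have hDI := mul_nonneg (decayConstant_pos hα hC₁ hK hK1).le hI
  have hvq : 0 < E.variance (u : V) ^ (-1 / (1 + α)) := Real.rpow_pos_of_pos hvar _
  set v : H.domain := ⟨E.proj R u - E.proj 0 u,
    H.domain.sub_mem (hE.proj_mem_domain _ _) (hE.proj_mem_domain _ _)⟩ with hv
  change ‖P t v‖ ^ 2 ≤ _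
  -- Negative powers of `‖P s v‖²` need positivity; as the norm is nonincreasing, `P t v ≠ 0`
  -- ensures it on all of `[0, t]`.
  rcases eq_or_ne (P t v) 0 with h0 | h0
  · rw [h0, norm_zero, zero_pow two_ne_zero]
    positivity
  have hpos : ∀ s ∈ Icc 0 t, 0 < ‖P s v‖ ^ 2 := fun s hs => by
    have h1 := hHP.norm_apply_le_of_mem_domain hP hE v hs.1 hs.2
    have h2 : 0 < ‖P t v‖ := norm_pos_iff.2 h0
    have : 0 < ‖P s v‖ := h2.trans_le h1
    positivity
  have hvle : ‖P 0 v‖ ^ 2 ≤ E.variance (u : V) := by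
    rw [hP.zero]
    exact E.norm_proj_sub_proj_zero_sq_le_variance R u hR
  have hconst : 2 * ((1 - K) * K ^ (1 / (1 + α)) * ((1 + α) / C₁) ^ (1 / (1 + α))) *
      (1 / (1 + α)) = decayConstant α C₁ K := by
    unfold decayConstant; ring
  have hbase : E.variance (u : V) ^ (-1 / (1 + α)) ≤ (‖P 0 v‖ ^ 2) ^ (-1 / (1 + α)) :=
    Real.rpow_le_rpow_of_nonpos (hpos 0 ⟨le_rfl, ht⟩) hvle hq
  have hdec := le_rpow_of_deriv_right_le (T := t) (φ := fun s => ‖P s v‖ ^ 2)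
    (φ' := fun s => 2 * ⟪P s v, -P s (H v)⟫)
    (w := fun s => (N u ^ 2 + C₂ * s ^ β) ^ (-1 / (1 + α)))
    (A := (1 - K) * K ^ (1 / (1 + α)) * ((1 + α) / C₁) ^ (1 / (1 + α)))
    hα ht hpos ((hP.continuousOn (v : V) t).norm.pow 2)
    (fun s hs => (hHP.hasDerivWithinAt hP v hs.1.le).norm_sq)
    (integrableOn_weight hm hC₂ hq t)
    (fun s hs => by
      have hs' := Ioo_subset_Icc_self hs
      obtain ⟨w, hw, hHw⟩ := hHP.exists_map_eq hP v hs.1.le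
      obtain ⟨hz, hNz⟩ := hPu s hs.1.le
      have hBm : N u ^ 2 ≤ N u ^ 2 + C₂ * s ^ β :=
        le_add_of_nonneg_right (mul_nonneg hC₂ (Real.rpow_nonneg hs.1.le _))
      have hw' : (w : V) = E.proj R (P s u) - E.proj 0 (P s u) := by
        rw [hw, hHP.proj_apply hP hE hH _ _ hs.1.le, hHP.proj_apply hP hE hH _ _ hs.1.le,
          ← map_sub]
      have hφle : ‖P s v‖ ^ 2 ≤ E.variance (u : V) :=
        (pow_le_pow_left₀ (norm_nonneg _)
          (hHP.norm_apply_le_of_mem_domain hP hE v le_rfl hs.1.le) 2).trans hvle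
      have hn := nash_of_forall_threshold (K := K) (φ := ‖P s v‖ ^ 2)
        (B := N u ^ 2 + C₂ * s ^ β) (e := ⟪H w, (w : V)⟫) hα hC₁ hr hK (hpos s hs')
        (hm.trans_le hBm)
        -- Admissibility of `K` persists in time: `‖P s v‖²` stays below `Var(u)`, and the bound on
        -- the `X`-norm only exceeds its initial value.
        (((mul_le_mul_of_nonneg_left hφle hK.le).trans hKr).trans
          (mul_le_mul_of_nonneg_left hBm (by positivity)))
        fun b hb => by
          have := hX.mul_norm_sq_sub_le_inner hE hR ⟨P s u, hz⟩ hNz w hw' hb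
          rwa [hw] at this ⊢
      rw [hHw, hw] at hn
      rw [inner_neg_right, real_inner_comm]
      linarith)
    (by rw [hconst]; exact add_pos_of_pos_of_nonneg (hvq.trans_le hbase) hDI)
  rw [hconst] at hdec
  refine hdec.trans (Real.rpow_le_rpow_of_nonpos (add_pos_of_pos_of_nonneg hvq hDI) ?_
    (by linarith))
  linarith

theorem variance_apply_le_rpow (hHP : IsNegGenerator H P)
    (hP : IsStronglyContinuousSemigroup P) (hE : E.IsResolutionOf H) (hH : H.IsFormalAdjoint H)
    (hX : DensityOfStatesBound E X N r C₁ α) (hC₂ : 0 ≤ C₂)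
    (hPu : ∀ t : ℝ, 0 ≤ t → ∃ h : P t (u : V) ∈ X,
      N ⟨P t (u : V), h⟩ ^ 2 ≤ N u ^ 2 + C₂ * t ^ β)
    (hNu : 0 < N u) (hvar : 0 < E.variance (u : V)) (hK : 0 < K) (hK1 : K < 1)
    (hKr : K * E.variance (u : V) ≤ C₁ / (1 + α) * r ^ (1 + α) * N u ^ 2) (ht : 0 ≤ t) :
    E.variance (P t (u : V)) ≤
      (E.variance (u : V) ^ (-1 / (1 + α)) + decayConstant α C₁ K *
        ∫ s in (0 : ℝ)..t, (N u ^ 2 + C₂ * s ^ β) ^ (-1 / (1 + α))) ^ (-(1 + α)) := by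
  rw [SpectralFamily.variance, hHP.proj_apply hP hE hH 0 _ ht, ← map_sub]
  have hlim : Tendsto (fun R => ‖P t (E.proj R u - E.proj 0 u)‖ ^ 2) atTop
      (𝓝 (‖P t (u - E.proj 0 u)‖ ^ 2)) :=
    ((((P t).continuous.tendsto _).comp ((E.tendsto_atTop (u : V)).sub_const _)).norm.pow 2)
  refine le_of_tendsto hlim ?_
  filter_upwards [eventually_ge_atTop 0] with R hR
  exact hHP.norm_sq_apply_spectral_cutoff_le hP hE hH hX hC₂ hPu hNu hvar hK hK1 hKr ht hR

end IsNegGenerator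

theorem DensityOfStatesBound.norm_pos_of_variance_pos (hX : DensityOfStatesBound E X N r C₁ α)
    {u : X} (hvar : 0 < E.variance (u : V)) : 0 < N u := by
  refine (apply_nonneg N u).lt_of_ne fun h => hvar.ne' ?_
  rw [hX.norm_definite u h.symm]
  simp [SpectralFamily.variance]

theorem DensityOfStatesBound.exists_threshold (hX : DensityOfStatesBound E X N r C₁ α) (u : X) :
    ∃ K : ℝ, 0 < K ∧ K < 1 ∧
      K * E.variance (u : V) ≤ C₁ / (1 + α) * r ^ (1 + α) * N u ^ 2 := by
  have ha : 0 < 1 + α := by linarith [hX.neg_one_lt]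
  have hr := hX.r_pos
  have hC := hX.C₁_pos
  rcases (E.variance_nonneg (u : V)).eq_or_lt with h0 | h0
  · refine ⟨1 / 2, by norm_num, by norm_num, ?_⟩
    rw [← h0, mul_zero]
    positivity
  · have hNu := hX.norm_pos_of_variance_pos h0
    set A := C₁ / (1 + α) * r ^ (1 + α) * N u ^ 2 with hA
    have hA0 : 0 < A := by positivity
    -- This `K` is below both `1` and `A / Var(u)`.
    refine ⟨A / (A + E.variance (u : V)), by positivity, ?_, ?_⟩
    · rw [div_lt_one (by positivity)]
      linarith
    · rw [div_mul_eq_mul_div, div_le_iff₀ (by positivity)]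
      nlinarith

end DensityOfStates

/-! ### Decay rates and conclusion. -/

theorem IsSelfAdjoint.isFormalAdjoint {V : Type*} [NormedAddCommGroup V] [InnerProductSpace ℝ V]
    [CompleteSpace V] {H : V →ₗ.[ℝ] V} (hH : IsSelfAdjoint H) : H.IsFormalAdjoint H := by
  have h := LinearPMap.adjoint_isFormalAdjoint hH.dense_domain
  rwa [LinearPMap.isSelfAdjoint_def.1 hH] at h

/-- Decay rates for a function dominated by `(V₀ + c ∫₀ᵗ (m + C s^β)^(-1/a))^(-a)`. -/
theorem isBigO_of_le_rpow_integral_weight {f : ℝ → ℝ} {V₀ c m C β γ a : ℝ} {g : ℝ → ℝ}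
    (ha : 0 < a) (hV₀ : 0 ≤ V₀) (hc : 0 < c) (hm : 0 < m) (hC : 0 ≤ C) (hγ : 0 ≤ γ)
    (hβγ : C = 0 ∨ β ≤ γ) (hf : ∀ t, 0 ≤ t → 0 ≤ f t)
    (hle : ∀ t, 0 ≤ t → f t ≤ (V₀ + c * ∫ s in (0 : ℝ)..t, (m + C * s ^ β) ^ (-1 / a)) ^ (-a))
    (hg : ∀ t, 2 ≤ t → 0 < g t)
    (hgi : ∀ t, 2 ≤ t → 1 / 2 * g t ≤ ∫ s in (1 : ℝ)..t, s ^ (γ * (-1 / a))) :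
    f =O[atTop] fun t => g t ^ (-a) := by
  have hq : -1 / a ≤ 0 := div_nonpos_of_nonpos_of_nonneg (by norm_num) ha.le
  refine isBigO_rpow_neg_of_le (c := c * ((m + C) ^ (-1 / a) * (1 / 2))) ha.le (by positivity)
    ((eventually_ge_atTop 0).mono hf) ((eventually_ge_atTop 0).mono hle)
    ((eventually_ge_atTop 2).mono hg) ((eventually_ge_atTop 2).mono fun t ht => ?_)
  have h := integral_rpow_le_integral_weight (β := β) hm hC hq hγ hβγ (t := t) (by linarith)
  have h' := mul_le_mul_of_nonneg_left (hgi t ht)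
    (Real.rpow_nonneg (by positivity : 0 ≤ m + C) (-1 / a))
  have h'' := mul_le_mul_of_nonneg_left (h'.trans h) hc.le
  linarith

theorem theorem1p2 {M : Type*} [MeasurableSpace M] (μ : Measure M)
    (H : Lp ℝ 2 μ →ₗ.[ℝ] Lp ℝ 2 μ) (hH : IsSelfAdjoint H)
    (hH_nonneg : ∀ u : H.domain, 0 ≤ ⟪H u, (u : Lp ℝ 2 μ)⟫)
    (P : ℝ → Lp ℝ 2 μ →L[ℝ] Lp ℝ 2 μ) (hP : IsMarkovSemigroup μ P) (hHP : IsNegGenerator H P)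
    (E : SpectralFamily (Lp ℝ 2 μ)) (hE : E.IsResolutionOf H)
    (X : Submodule ℝ (Lp ℝ 2 μ)) (N : Seminorm ℝ X) (r C₁ α : ℝ)
    (hX : DensityOfStatesBound E X N r C₁ α)
    (u : X) (C₂ β : ℝ) (hC₂ : 0 ≤ C₂)
    (hPu : ∀ t : ℝ, 0 ≤ t →
      ∃ h : P t (u : Lp ℝ 2 μ) ∈ X, N ⟨P t (u : Lp ℝ 2 μ), h⟩ ^ 2 ≤ N u ^ 2 + C₂ * t ^ β) :
    -- admissible parameters `K` exist, and the bound holds for each of them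
    (∃ K : ℝ, 0 < K ∧ K < 1 ∧
      K * E.variance (u : Lp ℝ 2 μ) ≤ C₁ / (1 + α) * r ^ (1 + α) * N u ^ 2) ∧
    (∀ K : ℝ, 0 < K → K < 1 →
      K * E.variance (u : Lp ℝ 2 μ) ≤ C₁ / (1 + α) * r ^ (1 + α) * N u ^ 2 →
      ∀ t : ℝ, 0 ≤ t →
        -- if `Var(u) = 0`, the right-hand side of the bound is read as `0`
        (E.variance (u : Lp ℝ 2 μ) = 0 → E.variance (P t (u : Lp ℝ 2 μ)) = 0) ∧
        (0 < E.variance (u : Lp ℝ 2 μ) →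
          E.variance (P t (u : Lp ℝ 2 μ)) ≤
            (E.variance (u : Lp ℝ 2 μ) ^ (-1 / (1 + α)) +
              decayConstant α C₁ K *
                ∫ s in (0 : ℝ)..t, (N u ^ 2 + C₂ * s ^ β) ^ (-1 / (1 + α))) ^ (-(1 + α)))) ∧
    -- decay rates as `t → ∞`
    (β = 1 + α → (fun t : ℝ => E.variance (P t (u : Lp ℝ 2 μ))) =O[atTop]
      fun t : ℝ => Real.log t ^ (-(1 + α))) ∧
    (0 < β → β < 1 + α → (fun t : ℝ => E.variance (P t (u : Lp ℝ 2 μ))) =O[atTop]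
      fun t : ℝ => t ^ (β - (1 + α))) ∧
    (C₂ = 0 ∨ β ≤ 0 → (fun t : ℝ => E.variance (P t (u : Lp ℝ 2 μ))) =O[atTop]
      fun t : ℝ => t ^ (-(1 + α))) := by
  have hS := hP.isStronglyContinuousSemigroup
  have hA := hH.isFormalAdjoint
  have hα := hX.neg_one_lt
  have ha : 0 < 1 + α := by linarith
  have hf : ∀ t, 0 ≤ t → 0 ≤ E.variance (P t (u : Lp ℝ 2 μ)) := fun t _ => E.variance_nonneg _
  have hzero : E.variance (u : Lp ℝ 2 μ) = 0 → ∀ t, 0 ≤ t →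
      E.variance (P t (u : Lp ℝ 2 μ)) = 0 := fun h0 t ht =>
    le_antisymm ((hHP.variance_apply_le hS hE hA _ ht).trans h0.le) (E.variance_nonneg _)
  -- `γ` is the effective growth exponent: `β` in the first two regimes, `0` in the last.
  have hrate : ∀ (γ : ℝ) (g : ℝ → ℝ), 0 ≤ γ → (C₂ = 0 ∨ β ≤ γ) → (∀ t, 2 ≤ t → 0 < g t) →
      (∀ t, 2 ≤ t → 1 / 2 * g t ≤ ∫ s in (1 : ℝ)..t, s ^ (γ * (-1 / (1 + α)))) →
      (fun t : ℝ => E.variance (P t (u : Lp ℝ 2 μ))) =O[atTop] fun t => g t ^ (-(1 + α)) := by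
    intro γ g hγ hβγ hg hgi
    rcases (E.variance_nonneg (u : Lp ℝ 2 μ)).eq_or_lt with h0 | h0
    · refine IsBigO.of_bound 0 ?_
      filter_upwards [eventually_ge_atTop 0] with t ht
      rw [hzero h0.symm t ht]
      simp
    · obtain ⟨K, hK, hK1, hKr⟩ := hX.exists_threshold u
      have hNu := hX.norm_pos_of_variance_pos h0
      exact isBigO_of_le_rpow_integral_weight ha (by positivity)
        (decayConstant_pos hα hX.C₁_pos hK hK1) (pow_pos hNu 2) hC₂ hγ hβγ hf
        (fun t ht => hHP.variance_apply_le_rpow hS hE hA hX hC₂ hPu hNu h0 hK hK1 hKr ht) hg hgi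
  have hpow : ∀ γ : ℝ, 0 ≤ γ → (C₂ = 0 ∨ β ≤ γ) →
      (fun t : ℝ => E.variance (P t (u : Lp ℝ 2 μ))) =O[atTop]
        fun t => t ^ (γ - (1 + α)) := by
    intro γ hγ hβγ
    refine (hrate γ (fun t => t ^ (1 + γ * (-1 / (1 + α)))) hγ hβγ
      (fun t ht => Real.rpow_pos_of_pos (by linarith) _) fun t ht =>
        half_mul_rpow_le_integral_rpow (mul_nonpos_of_nonneg_of_nonpos hγ
          (div_nonpos_of_nonpos_of_nonneg (by norm_num) ha.le)) ht).congr' EventuallyEq.rfl ?_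
    filter_upwards [eventually_ge_atTop 0] with t ht
    rw [← Real.rpow_mul ht]
    congr 1
    field_simp
    ring
  refine ⟨hX.exists_threshold u, fun K hK hK1 hKr t ht => ⟨fun h0 => hzero h0 t ht, fun h0 =>
    hHP.variance_apply_le_rpow hS hE hA hX hC₂ hPu (hX.norm_pos_of_variance_pos h0) h0 hK hK1 hKr
      ht⟩, fun hβ => ?_, fun hβ0 _ => hpow β hβ0.le (Or.inr le_rfl), fun h => ?_⟩
  · refine hrate β Real.log (hβ ▸ ha.le) (Or.inr le_rfl)
      (fun t ht => Real.log_pos (by linarith)) fun t ht => ?_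
    -- At the critical exponent the comparison integrand is `1/s`, whence the logarithm.
    have h1 : β * (-1 / (1 + α)) = -1 := by rw [hβ]; field_simp
    have hlog := Real.log_pos (show (1 : ℝ) < t by linarith)
    simp_rw [h1, Real.rpow_neg_one]
    rw [integral_inv_of_pos one_pos (by linarith), div_one]
    linarith
  · simpa using hpow 0 le_rfl h
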